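/- Let $A$ and $U$ be the permutations of the $23$ letters $\mathbb{Z}/23\mathbb{Z}$ given by $A(z)=z+1$ and $$U=(2,16,9,6,8)(4,3,12,13,18)(10,11,22,7,17)(20,15,14,19,21),$$ and let $G_{23}=\langle A,U\rangle$. Adjoin a letter $\infty$, extend $A$ and $U$ by $\infty\mapsto\infty$, let $T(z)=-1/z$ (so that $T$ exchanges $0$ and $\infty$), and let $G_{24}=\langle A,U,T\rangle$, a group of permutations of the $24$ letters $\mathbb{Z}/23\mathbb{Z}\cup\{\infty\}$ (now called $M_{24}$). For a polynomial $f$ in variables $x_i$, $i\in I$ ($I$ finite), with coefficients in a commutative ring, let $\mathrm{Sym}(f)$ be the group of all permutations of $I$ for which the corresponding permutation of the variables leaves $f$ unchanged. Call $f$ *$k$ times transitive* if $\mathrm{Sym}(f)$ acts transitively on the $k$-tuples of distinct elements of $I$; the *number of values* of $f$ is the number of distinct polynomials obtained from $f$ by permuting its variables. Then: 1. $G_{24}$ is $5$-transitive on the $24$ letters and has order $24\cdot23\cdot22\cdot21\cdot20\cdot(16\cdot3)$. $G_{23}$ is $4$-transitive on the $23$ letters and has order $23\cdot22\cdot21\cdot20\cdot(16\cdot3)$.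 A permutation of $\mathbb{Z}/23\mathbb{Z}$, extended by $\infty\mapsto\infty$, lies in $G_{24}$ if and only if it lies in $G_{23}$. 2. $G_{24}$ contains every substitution $z\mapsto\frac{az+b}{cz+d}$ with $a,b,c,d\in\mathbb{Z}/23\mathbb{Z}$ and $ad-bc$ a nonzero square. 3. Let $R$ be a nonzero commutative ring. There is a polynomial $f$ over $R$ in the $24$ variables $x_\infty,x_0,\dots,x_{22}$ with $\mathrm{Sym}(f)=G_{24}$. Every such $f$ is $5$ times transitive and has $\frac{19!}{16\cdot3}$ values. Considered as a function of $x_0,\dots,x_{22}$ alone (that is, as a polynomial in these $23$ variables with coefficients in $R[x_\infty]$), it has symmetry group exactly $G_{23}$, is $4$ times transitive, and has $\frac{19!}{16\cdot3}$ values. -/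

import Mathlib

open scoped Nat

section functions

variable {σ R : Type*} [CommSemiring R]

/-- The group of all permutations of the variables that leave the polynomial function `f` of the
quantities `x i` (`i : σ`) unchanged. -/
def symmetryGroup (f : MvPolynomial σ R) : Subgroup (Equiv.Perm σ) where
  carrier := {g | MvPolynomial.rename g f = f}
  one_mem' := by
    show MvPolynomial.rename (id : σ → σ) f = f
    exact MvPolynomial.rename_id_apply f
  mul_mem' := by
    intro g h hg hh
    show MvPolynomial.rename (g ∘ h) f = f
    rw [← MvPolynomial.rename_rename, show MvPolynomial.rename h f = f from hh]
    exact hg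
  inv_mem' := by
    intro g hg
    show MvPolynomial.rename (g⁻¹ : Equiv.Perm σ) f = f
    have hg' : MvPolynomial.rename g f = f := hg
    conv_lhs => rw [← hg', MvPolynomial.rename_rename]
    have : ((g⁻¹ : Equiv.Perm σ) ∘ g : σ → σ) = id := by ext x; simp
    rw [this, MvPolynomial.rename_id_apply]

/-- `f` is a `k` times transitive function of the quantities `x i`: the permutations that leave `f`
unchanged carry every `k`-tuple of distinct letters to every other one. -/
def IsTimesTransitive (k : ℕ) (f : MvPolynomial σ R) : Prop :=
  MulAction.IsMultiplyPretransitive (symmetryGroup f) σ k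

/-- The number of distinct values of `f`, that is, of distinct functions obtained from `f` by
permuting its variables in all possible ways. -/
noncomputable def numValues (f : MvPolynomial σ R) : ℕ :=
  (Set.range fun g : Equiv.Perm σ => MvPolynomial.rename g f).ncard

/-- A polynomial in `x i` (`i : σ`) and one more variable `x none`, considered as a function of the
`x i` alone: a polynomial in the `x i` whose coefficients are polynomials in `x none`. -/
noncomputable def asFunctionOfFirst (f : MvPolynomial (Option σ) R) :
    MvPolynomial σ (Polynomial R) :=
  MvPolynomial.optionEquivRight R σ f

end functions

namespace Mathieu

/-- The 24 letters: `some z` for the residues `z` modulo 23, and `none` for `∞`. -/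
abbrev Letters24 : Type := Option (ZMod 23)

/-- The substitution `z ↦ z + 1` modulo 23. -/
def substA : Equiv.Perm (ZMod 23) := Equiv.addRight 1

/-- The product of four disjoint 5-cycles; `[a, b, …].formPerm` sends `a` to `b`, and so on. -/
def substU : Equiv.Perm (ZMod 23) :=
  [2, 16, 9, 6, 8].formPerm * [4, 3, 12, 13, 18].formPerm *
    [10, 11, 22, 7, 17].formPerm * [20, 15, 14, 19, 21].formPerm

/-- The map `z ↦ (a z + b) / (c z + d)` on the residues modulo 23 together with `∞`. -/
def mobius (a b c d : ZMod 23) : Letters24 → Letters24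
  | none => if c = 0 then none else some (a * c⁻¹)
  | some z => if c * z + d = 0 then none else some ((a * z + b) * (c * z + d)⁻¹)

theorem mobius_neg_inv_involutive : Function.Involutive (mobius 0 (-1) 1 0) := by
  have : Fact (Nat.Prime 23) := ⟨by norm_num⟩
  rintro (_ | z)
  · simp [mobius]
  · by_cases hz : z = 0
    · simp [mobius, hz]
    · simp [mobius, hz]

/-- The substitution `z ↦ -1 / z` of the 24 letters, which exchanges `0` and `∞`. -/
def substNegInv : Equiv.Perm Letters24 := mobius_neg_inv_involutive.toPerm

/-- The group of permutations of the 23 letters generated by `z ↦ z + 1` and `substU`. -/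
def group23 : Subgroup (Equiv.Perm (ZMod 23)) := Subgroup.closure {substA, substU}

/-- The group of permutations of the 24 letters generated by `z ↦ z + 1` and `substU`, both
fixing `∞`, and by `z ↦ -1 / z`. -/
def group24 : Subgroup (Equiv.Perm Letters24) :=
  Subgroup.closure {Equiv.optionCongr substA, Equiv.optionCongr substU, substNegInv}

end Mathieu

/-!
The group on 24 letters preserves the extended binary Golay code, here the family of all symmetric
differences of the blocks `{∞} ∪ {z | z - i is not a square}`, `i` modulo 23: each of the three
generators carries every block to a sum of blocks (`Mathieu.group24_le_stabilizer`). All the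
results on the orders come from playing this invariance against explicit elements of the groups.

*Transitivity.* Explicit words in `A` and `U` show that, in the group on 23 letters, the pointwise
fixers along the chain `0, 1, 5, 2, 4, 3` have orbits of at least 23, 22, 21, 20, 16 and 3 letters.
The first four steps give 4-transitivity, and `T` moves `∞`, so the group on 24 letters is
5-transitive (`Equiv.Perm.isMultiplyPretransitive_option`).

*Orders.* The code is self-orthogonal and all its weights are divisible by 4. A word of weight 4
could be moved by a 4-transitive group to a word meeting it in three letters, which contradicts
self-orthogonality; so the minimum distance is at least 8 (`Mathieu.eq_empty_of_card_lt`), and two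
octads with five common letters coincide. A symmetry fixing `∞, 0, 1, 5, 2` therefore preserves the
octad through these letters, which bounds the last two orbits by 16 and 3, and one fixing also `4`
and `3` is trivial, because intersections of octads successively single out all letters
(`Mathieu.eq_one_of_fixes`). The bounds match. They apply to the group on 23 letters as well as to
the whole stabilizer of `∞` in the group on 24 letters, so these two groups are equal
(`Mathieu.card_of_group23_le`, `Mathieu.comap_group24_eq`).

*Fractional linear substitutions.* The word `Mathieu.substDouble` is `z ↦ 2 z`, and 2 generates the
nonzero squares modulo 23; with `A` and `T` this yields all substitutions whose determinant is a
nonzero square (`Mathieu.exists_mobius_mem`).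

*Polynomials.* Summing the conjugates of a monomial with distinct exponents gives a polynomial with
any prescribed symmetry group (`exists_symmetryGroup_eq`); the numbers of values are indices of
symmetry groups, and treating `x_∞` as a coefficient replaces the symmetry group by its stabilizer
of `∞` (`symmetryGroup_asFunctionOfFirst`).
-/

/-! ### Permutation groups: pointwise fixers and one-point extensions -/

namespace Equiv.Perm

variable {α : Type*}

/-- The subgroup of those elements of `H` that fix every letter of the list `l`. -/
def pointwiseFixer (H : Subgroup (Perm α)) (l : List α) : Subgroup (Perm α) :=
  H ⊓ fixingSubgroup (Perm α) {y | y ∈ l}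

theorem mem_pointwiseFixer {H : Subgroup (Perm α)} {l : List α} {g : Perm α} :
    g ∈ pointwiseFixer H l ↔ g ∈ H ∧ ∀ y ∈ l, g y = y := by
  simp [pointwiseFixer, mem_fixingSubgroup_iff]

theorem pointwiseFixer_nil (H : Subgroup (Perm α)) : pointwiseFixer H [] = H := by
  ext g; simp [mem_pointwiseFixer]

/-- Orbit–stabilizer for one step in a chain of pointwise fixers: `S` is the orbit of `b`. -/
theorem card_pointwiseFixer (H : Subgroup (Perm α)) (l : List α) (b : α) (S : Finset α)
    (hS : ∀ z, z ∈ S ↔ ∃ g ∈ pointwiseFixer H l, g b = z) :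
    Nat.card (pointwiseFixer H l) = S.card * Nat.card (pointwiseFixer H (b :: l)) := by
  rw [← Nat.card_congr (MulAction.orbitProdStabilizerEquivGroup (pointwiseFixer H l) b),
    Nat.card_prod]
  congr 1
  · rw [← Nat.card_eq_finsetCard S]
    refine Nat.card_congr (Equiv.setCongr ?_)
    ext z
    simp only [Finset.mem_coe, hS, MulAction.mem_orbit_iff]
    constructor
    · rintro ⟨g, rfl⟩; exact ⟨g, g.2, rfl⟩
    · rintro ⟨g, hg, rfl⟩; exact ⟨⟨g, hg⟩, rfl⟩
  · refine Nat.card_congr ⟨fun g => ⟨g.1.1, ?_⟩, fun g => ⟨⟨g.1, ?_⟩, ?_⟩,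
      fun _ => rfl, fun _ => rfl⟩
    · have h1 := mem_pointwiseFixer.1 g.1.2
      have h2 : g.1.1 b = b := g.2
      exact mem_pointwiseFixer.2 ⟨h1.1, by simpa [h2] using h1.2⟩
    · have h1 := mem_pointwiseFixer.1 g.2
      exact mem_pointwiseFixer.2 ⟨h1.1, fun y hy => h1.2 y (List.mem_cons_of_mem _ hy)⟩
    · exact (mem_pointwiseFixer.1 g.2).2 b (by simp)

/-- Extending permutations of `α` to `Option α` by fixing `none`, as a group homomorphism. -/
def optionCongrHom (α : Type*) : Perm α →* Perm (Option α) where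
  toFun := Equiv.optionCongr
  map_one' := Equiv.optionCongr_one
  map_mul' g h := by ext (_ | x) <;> simp

theorem optionCongrHom_injective : Function.Injective (optionCongrHom α) :=
  Equiv.optionCongr_injective

theorem exists_optionCongr_eq {g : Perm (Option α)} (hg : g none = none) :
    ∃ h : Perm α, Equiv.optionCongr h = g := by
  refine ⟨Equiv.removeNone g, ?_⟩
  ext1 x
  cases x with
  | none => simp [hg]
  | some x =>
    have : g (some x) ≠ none := fun h => by simpa using g.injective (h.trans hg.symm)
    obtain ⟨y, hy⟩ := Option.ne_none_iff_exists'.1 this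
    simp [Equiv.removeNone_some g ⟨y, hy⟩]

/-- A subgroup of `Perm (Option α)` that is transitive consists of `|α| + 1` cosets of the
subgroup fixing `none`. -/
theorem card_eq_card_mul_card_comap_optionCongrHom [Fintype α] (G : Subgroup (Perm (Option α)))
    (hG : ∀ z, ∃ g ∈ G, g none = z) :
    Nat.card G = (Fintype.card α + 1) * Nat.card (G.comap (optionCongrHom α)) := by
  have h := card_pointwiseFixer G [] none Finset.univ (by simpa [pointwiseFixer_nil] using hG)
  rw [pointwiseFixer_nil, Finset.card_univ, Fintype.card_option] at h
  rw [h]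
  congr 1
  rw [Nat.card_congr ((G.comap (optionCongrHom α)).equivMapOfInjective _
    optionCongrHom_injective).toEquiv]
  congr! 2
  ext g
  rw [mem_pointwiseFixer, Subgroup.mem_map]
  constructor
  · rintro ⟨hg, h0⟩
    obtain ⟨k, rfl⟩ := exists_optionCongr_eq (h0 none (by simp))
    exact ⟨k, hg, rfl⟩
  · rintro ⟨k, hk, rfl⟩
    exact ⟨hk, by simp [optionCongrHom]⟩

/-- One-point extension: a transitive group on `Option α` that contains an `n`-transitive group on
`α` (extended by fixing `none`) is `(n + 1)`-transitive. -/
theorem isMultiplyPretransitive_option {n : ℕ} {K : Subgroup (Perm α)}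
    {G : Subgroup (Perm (Option α))} (hK : MulAction.IsMultiplyPretransitive K α n)
    (hKG : K ≤ G.comap (optionCongrHom α)) (hG : ∀ z, ∃ g ∈ G, g none = z) :
    MulAction.IsMultiplyPretransitive G (Option α) (n + 1) := by
  have key : ∀ x : Fin (n + 1) ↪ Option α, ∃ g ∈ G, ∃ y : Fin n ↪ α,
      g (x 0) = none ∧ ∀ i : Fin n, g (x i.succ) = some (y i) := by
    intro x
    obtain ⟨g, hg, h0⟩ := hG (x 0)
    have h0' : g⁻¹ (x 0) = none := by rw [← h0]; simp
    have hne (i : Fin n) : g⁻¹ (x i.succ) ≠ none := fun h =>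
      Fin.succ_ne_zero i (x.injective (g⁻¹.injective (h.trans h0'.symm)))
    choose y hy using fun i => Option.ne_none_iff_exists'.1 (hne i)
    refine ⟨g⁻¹, G.inv_mem hg, ⟨y, fun i j hij => ?_⟩, h0', hy⟩
    have : g⁻¹ (x i.succ) = g⁻¹ (x j.succ) := by rw [hy, hy, hij]
    exact Fin.succ_injective _ (x.injective (g⁻¹.injective this))
  refine MulAction.isMultiplyPretransitive_iff.2 fun x x' => ?_
  obtain ⟨g, hg, y, hg0, hy⟩ := key x
  obtain ⟨g', hg', y', hg0', hy'⟩ := key x'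
  obtain ⟨k, hk⟩ := MulAction.isMultiplyPretransitive_iff.1 hK y y'
  refine ⟨⟨g'⁻¹ * Equiv.optionCongr k.1 * g, G.mul_mem (G.mul_mem (G.inv_mem hg') (hKG k.2)) hg⟩,
    ?_⟩
  ext1 i
  show (g'⁻¹ * Equiv.optionCongr k.1 * g) (x i) = x' i
  rw [mul_apply, mul_apply, inv_eq_iff_eq]
  refine Fin.cases ?_ (fun j => ?_) i
  · simp [hg0, hg0']
  · have hj : k.1 (y j) = y' j := DFunLike.congr_fun hk j
    simp [hy, hy', hj]

end Equiv.Perm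

/-! ### Symmetry groups and numbers of values of polynomials -/

section Polynomials

open MvPolynomial

variable {σ R : Type*}

theorem mem_symmetryGroup [CommSemiring R] {f : MvPolynomial σ R} {g : Equiv.Perm σ} :
    g ∈ symmetryGroup f ↔ rename g f = f := Iff.rfl

/-- Lagrange's count: the values of `f` correspond to the cosets of its symmetry group. -/
theorem numValues_mul_card_symmetryGroup [CommSemiring R] [Finite σ] (f : MvPolynomial σ R) :
    numValues f * Nat.card (symmetryGroup f) = (Nat.card σ)! := by
  have hker : Setoid.ker (fun g : Equiv.Perm σ => rename g f) =
      QuotientGroup.leftRel (symmetryGroup f) := by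
    ext g h
    rw [Setoid.ker_def, QuotientGroup.leftRel_apply, mem_symmetryGroup, Equiv.Perm.coe_mul,
      ← rename_rename]
    constructor
    · intro e
      rw [← e, rename_rename, ← Equiv.Perm.coe_mul, inv_mul_cancel, Equiv.Perm.coe_one,
        rename_id_apply]
    · intro e
      conv_lhs => rw [← e]
      rw [rename_rename, ← Equiv.Perm.coe_mul, mul_inv_cancel, Equiv.Perm.coe_one,
        rename_id_apply]
  rw [← Nat.card_perm, ← (symmetryGroup f).index_mul_card]
  congr 1
  rw [numValues, ← Nat.card_coe_set_eq,
    ← Nat.card_congr (Setoid.quotientKerEquivRange fun g : Equiv.Perm σ => rename g f), hker]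
  rfl

/-- Every group `G` of permutations of finitely many variables is the symmetry group of a
polynomial: the sum of the `G`-conjugates of a monomial with pairwise distinct exponents. -/
theorem exists_symmetryGroup_eq (R : Type*) [CommSemiring R] [Nontrivial R] [Finite σ]
    (G : Subgroup (Equiv.Perm σ)) : ∃ f : MvPolynomial σ R, symmetryGroup f = G := by
  classical
  cases nonempty_fintype σ
  let e : σ →₀ ℕ := Finsupp.equivFunOnFinite.symm fun x => (Fintype.equivFin σ x : ℕ)
  have he : Function.Injective e := fun x y h =>
    (Fintype.equivFin σ).injective (Fin.ext h)
  have hmap : ∀ g h : Equiv.Perm σ, e.mapDomain g = e.mapDomain h → g = h := by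
    intro g h hgh
    ext1 x
    have h1 := DFunLike.congr_fun hgh (g x)
    rw [Finsupp.mapDomain_apply g.injective] at h1
    conv_rhs at h1 => rw [← h.apply_symm_apply (g x)]
    rw [Finsupp.mapDomain_apply h.injective] at h1
    rw [he h1, h.apply_symm_apply, ← he h1]
  let f : MvPolynomial σ R := ∑ g : G, monomial (e.mapDomain g.1) 1
  -- distinct conjugates of the monomial do not interfere, so each coefficient is 0 or 1
  have hcoeff (h : Equiv.Perm σ) : coeff (e.mapDomain h) f = if h ∈ G then 1 else 0 := by
    simp only [f, coeff_sum, coeff_monomial]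
    split_ifs with hh
    · rw [Finset.sum_eq_single ⟨h, hh⟩] <;> simp +contextual [Subtype.ext_iff]
      exact fun g _ hne he => absurd (hmap _ _ he) hne
    · exact Finset.sum_eq_zero fun g _ => if_neg fun he => hh (hmap g.1 h he ▸ g.2)
  refine ⟨f, le_antisymm (fun h hh => ?_) fun h hh => ?_⟩
  · -- compare the coefficients of the conjugate monomial in `f = rename h f`
    by_contra hG
    have h1 := coeff_rename_mapDomain (R := R) h h.injective f e
    rw [mem_symmetryGroup.1 hh, hcoeff, if_neg hG] at h1
    have h2 := hcoeff 1
    rw [if_pos G.one_mem, Equiv.Perm.coe_one, Finsupp.mapDomain_id] at h2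
    exact zero_ne_one (h1.trans h2)
  · rw [mem_symmetryGroup, map_sum]
    refine Fintype.sum_equiv (Equiv.mulLeft (⟨h, hh⟩ : G)) _ _ fun g => ?_
    rw [rename_monomial, ← Finsupp.mapDomain_comp]
    rfl

theorem asFunctionOfFirst_rename_optionCongr [CommSemiring R] (g : Equiv.Perm σ)
    (f : MvPolynomial (Option σ) R) :
    asFunctionOfFirst (rename (Equiv.optionCongr g) f) = rename g (asFunctionOfFirst f) := by
  induction f using MvPolynomial.induction_on with
  | C a => simp [asFunctionOfFirst]
  | add p q hp hq => simpa [asFunctionOfFirst] using congrArg₂ (· + ·) hp hq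
  | mul_X p i hp =>
    simp only [asFunctionOfFirst, map_mul] at hp ⊢
    rw [hp]
    cases i <;> simp

/-- The symmetries of `f` as a function of the `x i` alone are the symmetries that fix the extra
variable. -/
theorem symmetryGroup_asFunctionOfFirst [CommSemiring R] (f : MvPolynomial (Option σ) R) :
    symmetryGroup (asFunctionOfFirst f) =
      (symmetryGroup f).comap (Equiv.Perm.optionCongrHom σ) := by
  ext g
  rw [mem_symmetryGroup, ← asFunctionOfFirst_rename_optionCongr]
  exact (optionEquivRight R σ).injective.eq_iff

end Polynomials

namespace Mathieu

open Equiv.Perm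

/-! ### Transitivity of the group on 23 letters -/

/-- The product `A ^ i₁ * U ^ j₁ * A ^ i₂ * U ^ j₂ * ⋯` for the list of exponents
`[(i₁, j₁), (i₂, j₂), …]`. -/
def word (l : List (ℕ × ℕ)) : Equiv.Perm (ZMod 23) :=
  (l.map fun p => substA ^ p.1 * substU ^ p.2).prod

theorem word_mem (l : List (ℕ × ℕ)) : word l ∈ group23 := by
  refine list_prod_mem fun g hg => ?_
  obtain ⟨p, -, rfl⟩ := List.mem_map.1 hg
  exact mul_mem (pow_mem (Subgroup.subset_closure (by simp)) _)
    (pow_mem (Subgroup.subset_closure (by simp)) _)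

/-- The substitution `z ↦ 2 z`, as a word in the generators. -/
def substDouble : Equiv.Perm (ZMod 23) := word [(0, 1), (12, 4), (3, 4), (4, 2), (22, 0)]

theorem substDouble_apply : ∀ z, substDouble z = 2 * z := by decide +kernel

theorem word_mem_pointwiseFixer {ws : List (ℕ × ℕ)} {l : List (ZMod 23)}
    (h : ∀ y ∈ l, word ws y = y) : word ws ∈ pointwiseFixer group23 l :=
  mem_pointwiseFixer.2 ⟨word_mem _, h⟩

/-! For each letter `b` of the chain `0, 1, 5, 2, 4, 3`, the lemmas `exists_apply_zero` to
`exists_apply_three` exhibit an orbit of `b` under the pointwise fixer, in `group23`, of the letters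
before `b`. The exponent lists give explicit elements of that fixer, and every letter claimed to
lie in the orbit is reached from `b` by a product of powers of these elements. -/

theorem exists_apply_zero (z : ZMod 23) : ∃ g ∈ pointwiseFixer group23 [], g 0 = z := by
  have hA : substA ∈ pointwiseFixer group23 [] :=
    mem_pointwiseFixer.2 ⟨Subgroup.subset_closure (by simp), by simp⟩
  refine ⟨substA ^ z.val, pow_mem hA _, ?_⟩
  revert z
  decide +kernel

theorem exists_apply_one {z : ZMod 23} (hz : z ∉ [0]) :
    ∃ g ∈ pointwiseFixer group23 [0], g 1 = z := by
  have key : ∀ z : ZMod 23, z ∉ [0] → ∃ i < 11, ∃ j < 2,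
      (substDouble ^ i * word [(1, 1), (11, 0)] ^ j) 1 = z := by decide +kernel
  obtain ⟨i, -, j, -, h⟩ := key z hz
  exact ⟨_, mul_mem (pow_mem (word_mem_pointwiseFixer (by decide +kernel)) _)
    (pow_mem (word_mem_pointwiseFixer (by decide +kernel)) _), h⟩

theorem exists_apply_five {z : ZMod 23} (hz : z ∉ [1, 0]) :
    ∃ g ∈ pointwiseFixer group23 [1, 0], g 5 = z := by
  have key : ∀ z : ZMod 23, z ∉ [1, 0] → ∃ i < 5, ∃ j < 7,
      (word [(0, 1)] ^ i * word [(5, 1), (13, 0)] ^ j) 5 = z := by decide +kernel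
  obtain ⟨i, -, j, -, h⟩ := key z hz
  exact ⟨_, mul_mem (pow_mem (word_mem_pointwiseFixer (by decide +kernel)) _)
    (pow_mem (word_mem_pointwiseFixer (by decide +kernel)) _), h⟩

theorem exists_apply_two {z : ZMod 23} (hz : z ∉ [5, 1, 0]) :
    ∃ g ∈ pointwiseFixer group23 [5, 1, 0], g 2 = z := by
  have key : ∀ z : ZMod 23, z ∉ [5, 1, 0] → ∃ i < 5, ∃ j < 4,
      (word [(0, 1)] ^ i * word [(9, 1), (4, 2), (5, 1), (3, 0)] ^ j) 2 = z := by
    decide +kernel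
  obtain ⟨i, -, j, -, h⟩ := key z hz
  exact ⟨_, mul_mem (pow_mem (word_mem_pointwiseFixer (by decide +kernel)) _)
    (pow_mem (word_mem_pointwiseFixer (by decide +kernel)) _), h⟩

/-- The seven excluded letters form, together with `∞`, the octad through `∞, 0, 1, 5, 2`. -/
theorem exists_apply_four {z : ZMod 23} (hz : z ∉ [0, 1, 2, 3, 5, 14, 17]) :
    ∃ g ∈ pointwiseFixer group23 [2, 5, 1, 0], g 4 = z := by
  have key : ∀ z : ZMod 23, z ∉ [0, 1, 2, 3, 5, 14, 17] → ∃ i < 3, ∃ j < 3, ∃ k < 3,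
      (word [(15, 1), (1, 3), (1, 4), (3, 0)] ^ i * word [(20, 1), (1, 4), (1, 3), (7, 0)] ^ j *
        word [(2, 1), (1, 4), (3, 4), (1, 0)] ^ k) 4 = z := by
    decide +kernel
  obtain ⟨i, -, j, -, k, -, h⟩ := key z hz
  exact ⟨_, mul_mem (mul_mem (pow_mem (word_mem_pointwiseFixer (by decide +kernel)) _)
    (pow_mem (word_mem_pointwiseFixer (by decide +kernel)) _))
    (pow_mem (word_mem_pointwiseFixer (by decide +kernel)) _), h⟩

/-- The letters `3, 14, 17` are the other letters of the octad through `∞, 0, 1, 5, 2`. -/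
theorem exists_apply_three {z : ZMod 23} (hz : z ∈ [3, 14, 17]) :
    ∃ g ∈ pointwiseFixer group23 [4, 2, 5, 1, 0], g 3 = z := by
  have key : ∀ z ∈ ([3, 14, 17] : List (ZMod 23)), ∃ i < 3,
      (word [(21, 2), (22, 2), (9, 1), (8, 0)] ^ i) 3 = z := by
    decide +kernel
  obtain ⟨i, -, h⟩ := key z hz
  exact ⟨_, pow_mem (word_mem_pointwiseFixer (by decide +kernel)) _, h⟩

/-- The stabilizer chain through `0, 1, 5, 2` moves any four distinct letters to these. -/
theorem isMultiplyPretransitive_group23 :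
    MulAction.IsMultiplyPretransitive group23 (ZMod 23) 4 := by
  have move {l : List (ZMod 23)} {b x : ZMod 23}
      (h : ∃ g ∈ pointwiseFixer group23 l, g b = x) :
      ∃ g ∈ group23, g x = b ∧ ∀ y ∈ l, g y = y := by
    obtain ⟨g, hg, rfl⟩ := h
    obtain ⟨h1, h2⟩ := mem_pointwiseFixer.1 (inv_mem hg)
    exact ⟨g⁻¹, h1, by simp, h2⟩
  have key : ∀ x : Fin 4 ↪ ZMod 23, ∃ g ∈ group23, ∀ i, g (x i) = ![0, 1, 5, 2] i := by
    intro x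
    have hx (i j : Fin 4) (h : i ≠ j) (g : Equiv.Perm (ZMod 23)) : g (x i) ≠ g (x j) := by
      simpa using h
    obtain ⟨g₀, m₀, h₀, -⟩ := move (exists_apply_zero (x 0))
    obtain ⟨g₁, m₁, h₁, f₁⟩ := move (exists_apply_one (z := g₀ (x 1))
      (by simpa [h₀] using hx 1 0 (by decide) g₀))
    simp only [List.forall_mem_cons, List.not_mem_nil, false_imp_iff, implies_true, and_true] at f₁
    obtain ⟨g₂, m₂, h₂, f₂⟩ := move (exists_apply_five (z := g₁ (g₀ (x 2)))
      (by simpa [h₀, h₁, f₁] using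
        And.intro (hx 2 1 (by decide) (g₁ * g₀)) (hx 2 0 (by decide) (g₁ * g₀))))
    simp only [List.forall_mem_cons, List.not_mem_nil, false_imp_iff, implies_true, and_true] at f₂
    obtain ⟨g₃, m₃, h₃, f₃⟩ := move (exists_apply_two (z := g₂ (g₁ (g₀ (x 3))))
      (by simpa [h₀, h₁, f₁, h₂, f₂] using
        And.intro (hx 3 2 (by decide) (g₂ * g₁ * g₀)) (And.intro
          (hx 3 1 (by decide) (g₂ * g₁ * g₀)) (hx 3 0 (by decide) (g₂ * g₁ * g₀)))))
    simp only [List.forall_mem_cons, List.not_mem_nil, false_imp_iff, implies_true, and_true] at f₃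
    refine ⟨g₃ * g₂ * g₁ * g₀, mul_mem (mul_mem (mul_mem m₃ m₂) m₁) m₀, fun i => ?_⟩
    fin_cases i <;> simp [h₀, h₁, f₁, h₂, f₂, h₃, f₃]
  refine MulAction.isMultiplyPretransitive_iff.2 fun x x' => ?_
  obtain ⟨g, hg, h⟩ := key x
  obtain ⟨g', hg', h'⟩ := key x'
  refine ⟨⟨g'⁻¹ * g, mul_mem (inv_mem hg') hg⟩, ?_⟩
  ext1 i
  show (g'⁻¹ * g) (x i) = x' i
  rw [mul_apply, inv_eq_iff_eq, h, h']

/-- `group23`, extended by fixing `∞`, is contained in `group24`. -/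
theorem group23_le_comap : group23 ≤ group24.comap (optionCongrHom _) := by
  refine (Subgroup.closure_le _).2 ?_
  rintro g (rfl | rfl)
  · exact Subgroup.subset_closure (by simp [optionCongrHom])
  · exact Subgroup.subset_closure (by simp [optionCongrHom])

theorem exists_apply_none (z : Letters24) : ∃ g ∈ group24, g none = z := by
  cases z with
  | none => exact ⟨1, one_mem _, rfl⟩
  | some z =>
    obtain ⟨g, hg, hz⟩ := exists_apply_zero z
    refine ⟨Equiv.optionCongr g * substNegInv,
      mul_mem (group23_le_comap (mem_pointwiseFixer.1 hg).1) (Subgroup.subset_closure (by simp)),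
      ?_⟩
    simp [substNegInv, mobius, hz, show (1 : ZMod 23) ≠ 0 by decide]

theorem isMultiplyPretransitive_group24 :
    MulAction.IsMultiplyPretransitive group24 Letters24 5 :=
  isMultiplyPretransitive_option isMultiplyPretransitive_group23 group23_le_comap exists_apply_none
/-! ### The extended binary Golay code -/

section GolayCode

open scoped Pointwise symmDiff

/-- Membership in the `i`-th block, which consists of `∞` and of the letters `z` for which `z - i`
is not a square. -/
def inBlock (i : ZMod 23) : Letters24 → Bool
  | none => true
  | some z => !decide (IsSquare (z - i))

/-- The symmetric difference of the blocks with indices in `l`. -/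
def blockSum (l : List (ZMod 23)) : Finset Letters24 :=
  Finset.univ.filter fun x => l.foldr (fun i b => xor (inBlock i x) b) false = true

/-- The extended binary Golay code: the family of all symmetric differences of blocks. A word of
the code is identified with the set of letters at which it is nonzero. -/
def golayCode : Set (Finset Letters24) := Set.range blockSum

theorem blockSum_nil : blockSum [] = ∅ := by simp [blockSum]

theorem blockSum_append (l m : List (ZMod 23)) :
    blockSum (l ++ m) = blockSum l ∆ blockSum m := by
  have h (x : Letters24) : (l ++ m).foldr (fun i b => xor (inBlock i x) b) false =
      xor (l.foldr (fun i b => xor (inBlock i x) b) false)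
        (m.foldr (fun i b => xor (inBlock i x) b) false) := by
    induction l with
    | nil => simp
    | cons i l ih => simp only [List.cons_append, List.foldr_cons, ih, Bool.xor_assoc]
  ext x
  simp only [blockSum, Finset.mem_symmDiff, Finset.mem_filter, Finset.mem_univ, true_and, h]
  cases List.foldr (fun i b => xor (inBlock i x) b) false l <;> simp

theorem blockSum_cons (i : ZMod 23) (l : List (ZMod 23)) :
    blockSum (i :: l) = blockSum [i] ∆ blockSum l :=
  blockSum_append [i] l

theorem symmDiff_mem_golayCode {S T : Finset Letters24} (hS : S ∈ golayCode)
    (hT : T ∈ golayCode) : S ∆ T ∈ golayCode := by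
  obtain ⟨l, rfl⟩ := hS
  obtain ⟨m, rfl⟩ := hT
  exact ⟨l ++ m, blockSum_append l m⟩

theorem card_symmDiff_add_two_mul_card_inter {α : Type*} [DecidableEq α] (S T : Finset α) :
    (S ∆ T).card + 2 * (S ∩ T).card = S.card + T.card := by
  have h1 := Finset.card_sdiff_add_card_inter S T
  have h2 := Finset.card_sdiff_add_card_inter T S
  have h3 : (S ∆ T).card = (S \ T).card + (T \ S).card :=
    Finset.card_union_of_disjoint disjoint_sdiff_sdiff
  rw [Finset.inter_comm T S] at h2
  omega

theorem two_dvd_card_symmDiff_inter {S T V : Finset Letters24} (hS : 2 ∣ (S ∩ V).card)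
    (hT : 2 ∣ (T ∩ V).card) : 2 ∣ ((S ∆ T) ∩ V).card := by
  have h := card_symmDiff_add_two_mul_card_inter (S ∩ V) (T ∩ V)
  rw [← Finset.inf_eq_inter, ← Finset.inf_eq_inter, ← inf_symmDiff_distrib_right,
    Finset.inf_eq_inter] at h
  simp only [Finset.inf_eq_inter] at h
  omega

/-- The Golay code is self-orthogonal. -/
theorem two_dvd_card_inter {S T : Finset Letters24} (hS : S ∈ golayCode) (hT : T ∈ golayCode) :
    2 ∣ (S ∩ T).card := by
  -- bilinearity reduces the claim to pairs of blocks
  have h0 : ∀ i j : ZMod 23, 2 ∣ (blockSum [i] ∩ blockSum [j]).card := by decide +kernel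
  obtain ⟨l, rfl⟩ := hS
  obtain ⟨m, rfl⟩ := hT
  induction l with
  | nil => simp [blockSum_nil]
  | cons i l ih =>
    rw [blockSum_cons]
    refine two_dvd_card_symmDiff_inter ?_ ih
    clear ih
    induction m with
    | nil => simp [blockSum_nil]
    | cons j m ih =>
      rw [Finset.inter_comm] at ih ⊢
      rw [blockSum_cons]
      exact two_dvd_card_symmDiff_inter (h0 j i) ih

/-- The Golay code is doubly even: its blocks have twelve letters, and by self-orthogonality the
symmetric difference preserves divisibility by four. -/
theorem four_dvd_card {S : Finset Letters24} (hS : S ∈ golayCode) : 4 ∣ S.card := by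
  have h0 : ∀ i : ZMod 23, 4 ∣ (blockSum [i]).card := by decide +kernel
  obtain ⟨l, rfl⟩ := hS
  induction l with
  | nil => simp [blockSum_nil]
  | cons i l ih =>
    have h1 := two_dvd_card_inter (Set.mem_range_self [i]) (Set.mem_range_self l)
    have h2 := card_symmDiff_add_two_mul_card_inter (blockSum [i]) (blockSum l)
    rw [← blockSum_cons] at h2
    have h3 := h0 i
    omega

/-- A permutation that carries each block to a word of the code preserves the code. -/
theorem smul_mem_golayCode_of_blocks {g : Equiv.Perm Letters24} (c : ZMod 23 → List (ZMod 23))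
    (hc : ∀ i x, x ∈ blockSum [i] ↔ g x ∈ blockSum (c i)) {S : Finset Letters24}
    (hS : S ∈ golayCode) : g • S ∈ golayCode := by
  obtain ⟨l, rfl⟩ := hS
  induction l with
  | nil => exact ⟨[], by simp [blockSum_nil]⟩
  | cons i l ih =>
    rw [blockSum_cons, Finset.smul_finset_symmDiff]
    refine symmDiff_mem_golayCode ⟨c i, ?_⟩ ih
    ext x
    rw [← Finset.inv_smul_mem_iff, hc]
    simp

/-- The image of the `i`-th block under `substU`, as a symmetric difference of blocks. -/
def substUBlock : ZMod 23 → List (ZMod 23) :=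
  ![[0], [0, 1, 2, 6, 19], [0, 1, 7, 15, 20], [0, 1, 3, 12, 21], [0, 1, 5, 14, 19], [0, 7, 22],
    [0, 1, 5, 7, 11], [0, 10, 15], [0, 1, 9, 10, 18], [0, 2, 5, 10, 15], [0, 7, 20], [0, 14, 17],
    [0, 1, 2, 18, 19], [0, 1, 9, 12, 21], [0, 10, 22], [0, 11, 15], [0, 2, 7, 14, 17],
    [0, 14, 21], [0, 1, 4, 7, 8], [0, 5, 11], [0, 20, 21], [0, 5, 19], [0, 17, 19]]

/-- The image of the `i`-th block under `z ↦ -1 / z`, as a symmetric difference of blocks. -/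
def substNegInvBlock : ZMod 23 → List (ZMod 23) :=
  ![[1, 2, 3, 9, 12, 21], [1, 2, 8, 11, 20], [1, 2, 8, 20, 22], [1, 2, 5, 10, 16],
    [1, 2, 7, 13, 14], [0, 9], [1, 2, 4, 6, 18], [0, 13], [1, 2, 8, 11, 22], [1, 2, 10, 15, 16],
    [0, 16], [0, 2], [1, 2, 3, 9, 12], [1, 2, 13, 14, 17], [0, 18], [0, 3], [1, 2, 5, 15, 16],
    [0, 4], [1, 2, 7, 13, 17], [0, 6], [0, 8], [0, 12], [0, 1]]

/-- The three generators, hence all elements of `group24`, preserve the Golay code. -/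
theorem group24_le_stabilizer :
    group24 ≤ MulAction.stabilizer (Equiv.Perm Letters24) golayCode := by
  refine (Subgroup.closure_le _).2 ?_
  rintro g (rfl | rfl | rfl) <;> refine (MulAction.mem_stabilizer_set' (Set.toFinite _)).2
    fun S hS => ?_
  · exact smul_mem_golayCode_of_blocks (fun i => [i + 1]) (by decide +kernel) hS
  · exact smul_mem_golayCode_of_blocks substUBlock (by decide +kernel) hS
  · exact smul_mem_golayCode_of_blocks substNegInvBlock (by decide +kernel) hS

theorem smul_mem_golayCode {g : Equiv.Perm Letters24} (hg : g ∈ group24)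
    {S : Finset Letters24} (hS : S ∈ golayCode) : g • S ∈ golayCode :=
  (MulAction.mem_stabilizer_set' (Set.toFinite _)).1 (group24_le_stabilizer hg) hS

/-- The minimum distance of the Golay code is at least 8. A word of weight 4 is excluded by
transitivity: moving just one of its letters off the word gives a word that meets it in three
letters, against self-orthogonality. -/
theorem eq_empty_of_card_lt {S : Finset Letters24} (hS : S ∈ golayCode) (h : S.card < 8) :
    S = ∅ := by
  have h4 := four_dvd_card hS
  obtain h0 | h0 : S.card = 0 ∨ S.card = 4 := by omega
  · exact Finset.card_eq_zero.1 h0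
  exfalso
  obtain ⟨e, he⟩ : ∃ e, e ∉ S := by
    by_contra! hall
    have := Finset.eq_univ_iff_forall.2 hall
    rw [this] at h0
    revert h0
    decide
  obtain ⟨x, hx⟩ : ∃ x : Fin 4 ↪ Letters24, Finset.univ.map x = S :=
    ⟨((Finset.equivFinOfCardEq h0).symm.toEmbedding.trans (Function.Embedding.subtype _)), by
      ext y
      simp only [Finset.mem_map, Finset.mem_univ, true_and]
      constructor
      · rintro ⟨i, rfl⟩
        exact Subtype.coe_prop _
      · intro hy
        exact ⟨Finset.equivFinOfCardEq h0 ⟨y, hy⟩, by simp⟩⟩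
  have hxS (i : Fin 4) : x i ∈ S := by rw [← hx]; simp
  have hT : MulAction.IsMultiplyPretransitive group24 Letters24 4 := by
    have := isMultiplyPretransitive_group24
    exact MulAction.isMultiplyPretransitive_of_le (n := 5) (by norm_num) (by simp)
  -- `y` is `x` with its first letter replaced by the letter `e` outside `S`
  let y : Fin 4 ↪ Letters24 := x.setValue 0 e
  obtain ⟨g, hg⟩ := MulAction.isMultiplyPretransitive_iff.1 hT x y
  have hg0 : g.1 (x 0) = e :=
    (DFunLike.congr_fun hg 0).trans (Function.Embedding.setValue_eq x 0 e)
  have hgi (i : Fin 4) (hi : i ≠ 0) : g.1 (x i) = x i := by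
    have := DFunLike.congr_fun hg i
    rw [show y i = x i from Function.Embedding.setValue_eq_of_ne hi
      (fun h => he (h ▸ hxS i))] at this
    exact this
  have hcard : S ∩ g.1 • S = S.erase (x 0) := by
    ext z
    rw [Finset.mem_inter, Finset.mem_erase, Finset.mem_smul_finset, ← hx]
    simp only [Finset.mem_map, Finset.mem_univ, true_and]
    constructor
    · rintro ⟨⟨i, rfl⟩, _, ⟨j, rfl⟩, h⟩
      refine ⟨fun h' => ?_, i, rfl⟩
      rw [h'] at h
      by_cases hj : j = 0
      · subst hj
        exact he (hg0.symm.trans h ▸ hxS 0)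
      · exact hj (x.injective ((hgi j hj).symm.trans h))
    · rintro ⟨hz, i, rfl⟩
      exact ⟨⟨i, rfl⟩, x i, ⟨i, rfl⟩, hgi i fun h => hz (by rw [h])⟩
  have h2 := two_dvd_card_inter hS (smul_mem_golayCode g.2 hS)
  rw [hcard, Finset.card_erase_of_mem (hxS 0), h0] at h2
  omega

/-- An octad is determined by any five of its letters; so a symmetry of the code that fixes five
letters of an octad preserves the octad. -/
theorem smul_octad_eq {g : Equiv.Perm Letters24} (hg : g ∈ group24) {S F : Finset Letters24}
    (hS : S ∈ golayCode) (h8 : S.card = 8) (hF : ∀ x ∈ F, g x = x) (h5 : 5 ≤ (S ∩ F).card) :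
    g • S = S := by
  have h1 := card_symmDiff_add_two_mul_card_inter S (g • S)
  have h2 : (S ∩ F).card ≤ (S ∩ g • S).card := by
    refine Finset.card_le_card fun x hx => ?_
    obtain ⟨hxS, hxF⟩ := Finset.mem_inter.1 hx
    exact Finset.mem_inter.2 ⟨hxS, Finset.mem_smul_finset.2 ⟨x, hxS, hF x hxF⟩⟩
  rw [Finset.card_smul_finset, h8] at h1
  exact (symmDiff_eq_bot.1 (eq_empty_of_card_lt
    (symmDiff_mem_golayCode hS (smul_mem_golayCode hg hS)) (by omega))).symm

/-- The steps `(l, m, x)` propagate fixed letters from `F` to all letters: at each step, the octads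
with block lists `l` and `m` have five letters each in the set of letters reached so far, and `x`
is their only common letter outside that set. The octads may coincide. -/
def Propagates : Finset Letters24 → List (List (ZMod 23) × List (ZMod 23) × Letters24) → Prop
  | F, [] => F = Finset.univ
  | F, (l, m, x) :: steps =>
    ((blockSum l).card = 8 ∧ 5 ≤ (blockSum l ∩ F).card ∧ (blockSum m).card = 8 ∧
      5 ≤ (blockSum m ∩ F).card ∧ (blockSum l ∩ blockSum m) \ F = {x}) ∧
    Propagates (insert x F) steps

instance Propagates.decidable : ∀ F steps, Decidable (Propagates F steps)
  | _, [] => inferInstanceAs (Decidable (_ = _))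
  | F, (_, _, x) :: steps =>
    have := Propagates.decidable (insert x F) steps
    inferInstanceAs (Decidable (_ ∧ _))

theorem eq_one_of_propagates {g : Equiv.Perm Letters24} (hg : g ∈ group24)
    (steps : List (List (ZMod 23) × List (ZMod 23) × Letters24)) :
    ∀ F : Finset Letters24, Propagates F steps → (∀ x ∈ F, g x = x) → g = 1 := by
  induction steps with
  | nil =>
    intro F hF h
    ext1 x
    exact h x (by rw [show F = Finset.univ from hF]; exact Finset.mem_univ x)
  | cons s steps ih =>
    obtain ⟨l, m, x⟩ := s
    rintro F ⟨⟨hl8, hl5, hm8, hm5, hx⟩, hF⟩ h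
    refine ih _ hF fun y hy => ?_
    obtain rfl | hy := Finset.mem_insert.1 hy
    swap
    · exact h y hy
    have hl := smul_octad_eq hg (Set.mem_range_self l) hl8 h hl5
    have hm := smul_octad_eq hg (Set.mem_range_self m) hm8 h hm5
    have hFg : g • F = F := by
      refine Finset.eq_of_subset_of_card_le (fun z hz => ?_) (by rw [Finset.card_smul_finset])
      obtain ⟨w, hw, rfl⟩ := Finset.mem_smul_finset.1 hz
      rw [Equiv.Perm.smul_def, h w hw]
      exact hw
    have h1 : g • ((blockSum l ∩ blockSum m) \ F) = (blockSum l ∩ blockSum m) \ F := by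
      rw [Finset.smul_finset_sdiff, Finset.smul_finset_inter, hl, hm, hFg]
    rw [hx, Finset.smul_finset_singleton, Finset.singleton_inj] at h1
    exact h1

/-- The octads force a permutation fixing five letters of an octad, a sixth letter of it and a letter
outside it to be trivial. -/
theorem eq_one_of_fixes {g : Equiv.Perm Letters24} (hg : g ∈ group24)
    (h : ∀ x ∈ ({none, some 0, some 1, some 5, some 2, some 4, some 3} : Finset Letters24),
      g x = x) : g = 1 := by
  refine eq_one_of_propagates hg
    [([3, 7, 14], [0, 4, 6, 11], some 11), ([4, 8, 15], [3, 7, 14], some 20),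
     ([3, 7, 14], [3, 7, 14], some 19), ([2, 16, 17], [0, 4, 6, 11], some 13),
     ([0, 4, 6, 11], [0, 4, 6, 11], some 8), ([0, 15, 18], [4, 8, 15], some 21),
     ([4, 8, 15], [4, 8, 15], some 12), ([6, 9, 10], [0, 15, 18], some 14),
     ([0, 15, 18], [0, 15, 18], some 16), ([0, 5, 11, 13], [2, 16, 17], some 17),
     ([2, 16, 17], [2, 16, 17], some 10), ([6, 16, 20], [6, 9, 10], some 15),
     ([6, 9, 10], [6, 9, 10], some 9), ([6, 16, 20], [6, 16, 20], some 18),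
     ([0, 2, 5, 15], [0, 5, 11, 13], some 7), ([0, 5, 11, 13], [0, 5, 11, 13], some 22),
     ([0, 2, 5, 15], [0, 2, 5, 15], some 6)] _ ?_ h
  decide +kernel

end GolayCode

/-! ### The orders of the groups -/

open scoped Pointwise in
/-- A symmetry of the Golay code that fixes the five letters `∞, 0, 1, 5, 2` preserves the octad
`{∞, 0, 1, 2, 3, 5, 14, 17}` through them. -/
theorem apply_mem_octad_iff {g : Equiv.Perm (ZMod 23)}
    (hg : g ∈ pointwiseFixer (group24.comap (optionCongrHom _)) [2, 5, 1, 0]) (z : ZMod 23) :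
    g z ∈ [0, 1, 2, 3, 5, 14, 17] ↔ z ∈ [0, 1, 2, 3, 5, 14, 17] := by
  obtain ⟨h1, h2⟩ := mem_pointwiseFixer.1 hg
  have h3 : optionCongrHom _ g • blockSum [0, 10, 12] = blockSum [0, 10, 12] := by
    refine smul_octad_eq h1 (F := {none, some 2, some 5, some 1, some 0}) (Set.mem_range_self _)
      (by decide +kernel) ?_ (by decide +kernel)
    have := h2 0 (by simp)
    have := h2 1 (by simp)
    have := h2 2 (by simp)
    have := h2 5 (by simp)
    simp [optionCongrHom, *]
  -- the octad `{∞, 0, 1, 2, 3, 5, 14, 17}` is the sum of the blocks 0, 10 and 12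
  have h4 : ∀ z, some z ∈ blockSum [0, 10, 12] ↔ z ∈ [0, 1, 2, 3, 5, 14, 17] := by
    decide +kernel
  rw [← h4, ← h4, show some (g z) = optionCongrHom _ g • (some z : Letters24) from rfl]
  conv_lhs => rw [← h3]
  exact Finset.smul_mem_smul_finset_iff _

/-- The order of any group between `group23` and the stabilizer of `∞` in `group24`. The orbits in
the chain of pointwise fixers of `0, 1, 5, 2, 4, 3` are bounded below by elements of `group23` and
above by the octad through `∞, 0, 1, 5, 2`. -/
theorem card_of_group23_le {H : Subgroup (Equiv.Perm (ZMod 23))} (hH : group23 ≤ H)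
    (hH' : H ≤ group24.comap (optionCongrHom _)) :
    Nat.card H = 23 * 22 * 21 * 20 * (16 * 3) := by
  have mono {K L : Subgroup (Equiv.Perm (ZMod 23))} (hKL : K ≤ L) {l : List (ZMod 23)}
      {g : Equiv.Perm (ZMod 23)} (hg : g ∈ pointwiseFixer K l) : g ∈ pointwiseFixer L l :=
    mem_pointwiseFixer.2 ((mem_pointwiseFixer.1 hg).imp_left (hKL ·))
  have up {l : List (ZMod 23)} {b z : ZMod 23} (h : ∃ g ∈ pointwiseFixer group23 l, g b = z) :
      ∃ g ∈ pointwiseFixer H l, g b = z :=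
    h.imp fun g hg => ⟨mono hH hg.1, hg.2⟩
  -- the orbit of a letter outside `l` under the pointwise fixer of `l` avoids `l`
  have avoid {l : List (ZMod 23)} {b : ZMod 23} (hb : b ∉ l) {g : Equiv.Perm (ZMod 23)}
      (hg : g ∈ pointwiseFixer H l) : g b ∉ l := fun h =>
    hb (g.injective ((mem_pointwiseFixer.1 hg).2 _ h) ▸ h)
  -- `c0`, …, `c5` are the orbit lengths 23, 22, 21, 20, 16, 3; the last fixer is trivial by `c6`
  have c0 := card_pointwiseFixer H [] 0 Finset.univ
    (by simpa using fun z => up (exists_apply_zero z))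
  have c1 := card_pointwiseFixer H [0] 1 (Finset.univ.filter (· ∉ [0])) fun z =>
    ⟨fun h => up (exists_apply_one (by simpa using h)), by
      rintro ⟨g, hg, rfl⟩; simpa using avoid (by decide) hg⟩
  have c2 := card_pointwiseFixer H [1, 0] 5 (Finset.univ.filter (· ∉ [1, 0])) fun z =>
    ⟨fun h => up (exists_apply_five (by simpa using h)), by
      rintro ⟨g, hg, rfl⟩; simpa using avoid (by decide) hg⟩
  have c3 := card_pointwiseFixer H [5, 1, 0] 2 (Finset.univ.filter (· ∉ [5, 1, 0])) fun z =>
    ⟨fun h => up (exists_apply_two (by simpa using h)), by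
      rintro ⟨g, hg, rfl⟩; simpa using avoid (by decide) hg⟩
  have c4 := card_pointwiseFixer H [2, 5, 1, 0] 4
    (Finset.univ.filter (· ∉ [0, 1, 2, 3, 5, 14, 17])) fun z =>
    ⟨fun h => up (exists_apply_four (by simpa using h)), by
      rintro ⟨g, hg, rfl⟩
      rw [Finset.mem_filter, apply_mem_octad_iff (mono hH' hg)]
      exact ⟨Finset.mem_univ _, by decide⟩⟩
  have c5 := card_pointwiseFixer H [4, 2, 5, 1, 0] 3 (Finset.univ.filter (· ∈ [3, 14, 17]))
    fun z => ⟨fun h => up (exists_apply_three (by simpa using h)), by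
      rintro ⟨g, hg, rfl⟩
      obtain ⟨hgH, hgl⟩ := mem_pointwiseFixer.1 hg
      have h1 := (apply_mem_octad_iff (mono hH' (mem_pointwiseFixer.2
        ⟨hgH, fun y hy => hgl y (List.mem_cons_of_mem _ hy)⟩)) 3).2 (by decide)
      have h2 := avoid (b := 3) (by decide) hg
      have h3 : ∀ z : ZMod 23, z ∈ [0, 1, 2, 3, 5, 14, 17] → z ∉ [4, 2, 5, 1, 0] →
        z ∈ [3, 14, 17] := by decide
      simpa using h3 _ h1 h2⟩
  have c6 : pointwiseFixer H [3, 4, 2, 5, 1, 0] = ⊥ := by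
    refine (Subgroup.eq_bot_iff_forall _).2 fun g hg => ?_
    obtain ⟨hgH, hgl⟩ := mem_pointwiseFixer.1 hg
    refine optionCongrHom_injective ((eq_one_of_fixes (hH' hgH) ?_).trans (map_one _).symm)
    simp only [List.forall_mem_cons, List.not_mem_nil, false_imp_iff, implies_true,
      and_true] at hgl
    simp [optionCongrHom, hgl]
  rw [pointwiseFixer_nil] at c0
  rw [c0, c1, c2, c3, c4, c5, c6, Subgroup.card_bot]
  decide +kernel

/-- The stabilizer of `∞` in `group24` is `group23`: both have the same order. -/
theorem comap_group24_eq : group24.comap (optionCongrHom _) = group23 :=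
  (Subgroup.eq_of_le_of_card_ge group23_le_comap (by
    rw [card_of_group23_le le_rfl group23_le_comap,
      card_of_group23_le group23_le_comap le_rfl])).symm

theorem card_group23 : Nat.card group23 = 23 * 22 * 21 * 20 * (16 * 3) :=
  card_of_group23_le le_rfl group23_le_comap

theorem card_group24 : Nat.card group24 = 24 * 23 * 22 * 21 * 20 * (16 * 3) := by
  rw [card_eq_card_mul_card_comap_optionCongrHom _ exists_apply_none, comap_group24_eq,
    card_group23, ZMod.card]

/-! ### Fractional linear substitutions -/

theorem optionCongr_mem_group24 {g : Equiv.Perm (ZMod 23)} (hg : g ∈ group23) :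
    Equiv.optionCongr g ∈ group24 := group23_le_comap hg

/-- The affine substitutions `z ↦ s z + t` with a nonzero square `s` lie in `group23`, because `2`
generates the group of nonzero squares modulo 23. -/
theorem exists_affine_mem {s : ZMod 23} (hs : s ≠ 0) (hs' : IsSquare s) (t : ZMod 23) :
    ∃ g ∈ group23, ∀ z, g z = s * z + t := by
  have hA (n : ℕ) (z : ZMod 23) : (substA ^ n) z = z + n := by
    induction n with
    | zero => simp
    | succ n ih =>
      rw [pow_succ', mul_apply, ih]
      simp [substA, add_assoc]
  have hM (n : ℕ) (z : ZMod 23) : (substDouble ^ n) z = 2 ^ n * z := by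
    induction n with
    | zero => simp
    | succ n ih => rw [pow_succ', mul_apply, ih, substDouble_apply, pow_succ']; ring
  have h2 : ∀ r : ZMod 23, r * r ≠ 0 → ∃ n < 11, 2 ^ n = r * r := by decide +kernel
  obtain ⟨r, rfl⟩ := hs'
  obtain ⟨n, -, hn⟩ := h2 r hs
  refine ⟨substA ^ t.val * substDouble ^ n,
    mul_mem (pow_mem (Subgroup.subset_closure (by simp)) _) (pow_mem (word_mem _) _), fun z => ?_⟩
  rw [mul_apply, hA, hM, hn, ZMod.natCast_zmod_val]

/-- If `c ≠ 0` and `D = a d - b c`, then `(a z + b) / (c z + d) = a / c - 1 / w` with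
`w = (c² / D) z + c d / D`; if `c = 0` the substitution is affine. -/
theorem exists_mobius_mem {a b c d : ZMod 23} (h : a * d - b * c ≠ 0)
    (hsq : IsSquare (a * d - b * c)) : ∃ g ∈ group24, ∀ z, g z = mobius a b c d z := by
  have : Fact (Nat.Prime 23) := ⟨by norm_num⟩
  by_cases hc : c = 0
  · subst hc
    simp only [mul_zero, sub_zero] at h hsq
    have ha : a ≠ 0 := left_ne_zero_of_mul h
    have hd : d ≠ 0 := right_ne_zero_of_mul h
    obtain ⟨g, hg, hgz⟩ := exists_affine_mem (s := a * d⁻¹) (by simp [ha, hd])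
      (by
        rw [show a * d⁻¹ = a * d * (d⁻¹ * d⁻¹) by field_simp]
        exact hsq.mul ⟨_, rfl⟩) (b * d⁻¹)
    refine ⟨_, optionCongr_mem_group24 hg, ?_⟩
    rintro (_ | z)
    · simp [mobius]
    · simp only [Equiv.optionCongr_apply, Option.map_some, hgz, mobius, zero_mul, zero_add, hd,
        if_false]
      congr 1
      ring
  · set D := a * d - b * c with hD
    obtain ⟨g, hg, hgz⟩ := exists_affine_mem (s := c * c * D⁻¹) (by simp [hc, h])
      (IsSquare.mul ⟨_, rfl⟩ (hsq.inv)) (c * d * D⁻¹)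
    obtain ⟨k, hk, hkz⟩ := exists_affine_mem (s := 1) one_ne_zero (IsSquare.one) (a * c⁻¹)
    refine ⟨Equiv.optionCongr k * substNegInv * Equiv.optionCongr g,
      mul_mem (mul_mem (optionCongr_mem_group24 hk) (Subgroup.subset_closure (by simp)))
        (optionCongr_mem_group24 hg), ?_⟩
    rintro (_ | z)
    · simp [mobius, substNegInv, hc, hkz]
    · have hw : g z = c * D⁻¹ * (c * z + d) := by rw [hgz]; ring
      by_cases hz : c * z + d = 0
      · simp [mobius, substNegInv, hw, hz]
      · simp only [mul_apply, Equiv.optionCongr_apply, Option.map_some, hw, mobius, substNegInv,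
          Function.Involutive.coe_toPerm, one_mul, add_zero, zero_mul, zero_add, hz, if_false,
          mul_eq_zero, hc, inv_eq_zero, h, or_self, hkz]
        congr 1
        field_simp
        rw [hD]
        ring

end Mathieu

/-! ### The polynomials with symmetry group `group24` -/

/-- The number of values of `f` when the order of its symmetry group has the factor `m` in common
with the factorial `m * 19!` of the number of variables. -/
theorem numValues_mul_eq_factorial {σ R : Type*} [CommSemiring R] [Finite σ]
    (f : MvPolynomial σ R) {m : ℕ} (hm : m ≠ 0) (h : (Nat.card σ)! = m * 19 !)
    (hc : Nat.card (symmetryGroup f) = m * (16 * 3)) : numValues f * (16 * 3) = 19 ! := by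
  have := numValues_mul_card_symmetryGroup f
  rw [hc, h] at this
  exact Nat.eq_of_mul_eq_mul_left (Nat.pos_of_ne_zero hm) (by rw [← this]; ring)

theorem mainTheorem1 (R : Type*) [CommRing R] [Nontrivial R] :
    -- the permutation groups: transitivity, orders, and the permutations that fix `∞`
    (MulAction.IsMultiplyPretransitive Mathieu.group24 Mathieu.Letters24 5 ∧
      MulAction.IsMultiplyPretransitive Mathieu.group23 (ZMod 23) 4 ∧
      Nat.card Mathieu.group24 = 24 * 23 * 22 * 21 * 20 * (16 * 3) ∧
      Nat.card Mathieu.group23 = 23 * 22 * 21 * 20 * (16 * 3) ∧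
      (∀ g : Equiv.Perm (ZMod 23),
        Equiv.optionCongr g ∈ Mathieu.group24 ↔ g ∈ Mathieu.group23)) ∧
    -- the fractional linear substitutions whose determinant is a quadratic residue
    (∀ a b c d : ZMod 23, a * d - b * c ≠ 0 → IsSquare (a * d - b * c) →
      ∃ g ∈ Mathieu.group24, ∀ z, g z = Mathieu.mobius a b c d z) ∧
    -- the functions of 24 quantities characterised by the three substitutions
    (∃ f : MvPolynomial Mathieu.Letters24 R, symmetryGroup f = Mathieu.group24) ∧
    (∀ f : MvPolynomial Mathieu.Letters24 R, symmetryGroup f = Mathieu.group24 →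
      IsTimesTransitive 5 f ∧
      numValues f * (16 * 3) = 19 ! ∧
      symmetryGroup (asFunctionOfFirst f) = Mathieu.group23 ∧
      IsTimesTransitive 4 (asFunctionOfFirst f) ∧
      numValues (asFunctionOfFirst f) * (16 * 3) = 19 !) := by
  refine ⟨⟨Mathieu.isMultiplyPretransitive_group24, Mathieu.isMultiplyPretransitive_group23,
    Mathieu.card_group24, Mathieu.card_group23, fun g => ?_⟩,
    fun a b c d => Mathieu.exists_mobius_mem, exists_symmetryGroup_eq R _, fun f hf => ?_⟩
  · rw [← Mathieu.comap_group24_eq]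
    rfl
  · have hf' : symmetryGroup (asFunctionOfFirst f) = Mathieu.group23 := by
      rw [symmetryGroup_asFunctionOfFirst, hf, Mathieu.comap_group24_eq]
    refine ⟨?_, ?_, hf', ?_, ?_⟩
    · rw [IsTimesTransitive, hf]
      exact Mathieu.isMultiplyPretransitive_group24
    · refine numValues_mul_eq_factorial f (m := 24 * 23 * 22 * 21 * 20) (by norm_num) ?_ ?_
      · simp [Nat.factorial]
      · rw [hf, Mathieu.card_group24]
    · rw [IsTimesTransitive, hf']
      exact Mathieu.isMultiplyPretransitive_group23
    · refine numValues_mul_eq_factorial _ (m := 23 * 22 * 21 * 20) (by norm_num) ?_ ?_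
      · simp [Nat.factorial]
      · rw [hf', Mathieu.card_group23]
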